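/- Let $\langle \mathbb{V}(X),\mathbb{V}(Y),\ast\rangle$ be a superstructure model of nonstandard methods: $X$ is an infinite set of individuals, $Y$ is a set of individuals, $\mathbb{V}(X),\mathbb{V}(Y)$ are the superstructures over $X$ and $Y$ (with $X=Y$ allowed), and $\ast:\mathbb{V}(X)\to\mathbb{V}(Y)$ satisfies the transfer principle for bounded-quantifier formulas. For a set $S\in\mathbb{V}(X)$ and $\alpha\in{}^{\ast}S$, let $\mathfrak{U}_{\alpha}=\{A\subseteq S\mid \alpha\in{}^{\ast}A\}$, which is an ultrafilter on $S$. For ultrafilters $\mathcal{U}_1,\dots,\mathcal{U}_n$ on sets $S_1,\dots,S_n$, let $\mathcal{U}_1\otimes\dots\otimes\mathcal{U}_n$ be the ultrafilter on $S_1\times\dots\times S_n$ such that, for all $A\subseteq S_1\times\dots\times S_n$, $$A\in\mathcal{U}_1\otimes\dots\otimes\mathcal{U}_n\iff \{s_1\in S_1\mid\{s_2\in S_2\mid\dots\{s_n\in S_n\mid(s_1,\dots,s_n)\in A\}\in\mathcal{U}_n\dots\}\in\mathcal{U}_2\}\in\mathcal{U}_1.$$ A tuple $(\alpha_1,\dots,\alpha_n)\in{}^{\ast}(S_1\times\dots\times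 S_n)$ is called a tensor $n$-ple if $\mathfrak{U}_{(\alpha_1,\dots,\alpha_n)}=\mathfrak{U}_{\alpha_1}\otimes\dots\otimes\mathfrak{U}_{\alpha_n}$. **Theorem.** Let $k\ge 1$, let $S_1,\dots,S_{k+1}\in\mathbb{V}(X)$ be sets and let $(\alpha_1,\dots,\alpha_{k+1})\in{}^{\ast}(S_1\times\dots\times S_{k+1})$. The following are equivalent: 1. $(\alpha_1,\dots,\alpha_{k+1})$ is a tensor $(k+1)$-ple; 2. for every nonempty $F=\{i_1<\dots<i_l\}\subseteq\{1,\dots,k+1\}$, the tuple $(\alpha_{i_1},\dots,\alpha_{i_l})\in{}^{\ast}(S_{i_1}\times\dots\times S_{i_l})$ is a tensor $l$-ple. -/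

import Mathlib

universe u v

namespace NSA

/-! ### Superstructures -/

/-- The finite levels of the superstructure: `V₀(X) = X`, `Vₙ₊₁(X) = Vₙ(X) ∪ ℘(Vₙ(X))`. -/
def level (X : ZFSet.{u}) : ℕ → ZFSet.{u}
  | 0 => X
  | n + 1 => level X n ∪ (level X n).powerset

/-- `a ∈ V(X) = ⋃ₙ Vₙ(X)`. -/
def InSuper (X a : ZFSet.{u}) : Prop := ∃ n, a ∈ level X n

/-- The superstructure `V(X)`, as a type. -/
def Super (X : ZFSet.{u}) : Type (u + 1) := {a : ZFSet.{u} // InSuper X a}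

/-- The membership relation of `V(X)`. -/
instance (X : ZFSet.{u}) : Membership (Super X) (Super X) := ⟨fun A a => a.1 ∈ A.1⟩

/-- `X` is a base set: its elements are nonempty and behave as atoms (individuals) with respect
to `V(X)`, that is, no element of an element of `X` belongs to `V(X)`. -/
def IsBaseSet (X : ZFSet.{u}) : Prop :=
  ∅ ∉ X ∧ ∀ x ∈ X, ∀ a ∈ x, ¬ InSuper X a

/-- `S ∈ V(X)` is a set of the superstructure (as opposed to an individual). -/
def IsSet {X : ZFSet.{u}} (S : Super X) : Prop := S.1 ∉ X

/-! ### Bounded formulas and the transfer principle -/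

/-- Bounded-quantifier formulas in the language of set theory, with free variables among
`x₀, …, xₙ₋₁`. In `ball i φ` (that is, `∀ y ∈ xᵢ, φ`) and `bex i φ` (that is, `∃ y ∈ xᵢ, φ`) the
bound variable `y` is the last variable of `φ`. -/
inductive BFormula : ℕ → Type
  | mem {n : ℕ} (i j : Fin n) : BFormula n
  | eq {n : ℕ} (i j : Fin n) : BFormula n
  | not {n : ℕ} (φ : BFormula n) : BFormula n
  | and {n : ℕ} (φ ψ : BFormula n) : BFormula n
  | or {n : ℕ} (φ ψ : BFormula n) : BFormula n
  | imp {n : ℕ} (φ ψ : BFormula n) : BFormula n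
  | ball {n : ℕ} (i : Fin n) (φ : BFormula (n + 1)) : BFormula n
  | bex {n : ℕ} (i : Fin n) (φ : BFormula (n + 1)) : BFormula n

/-- Satisfaction of a bounded formula in `V(X)` at a tuple of elements of `V(X)`. -/
def BFormula.Holds {X : ZFSet.{u}} : {n : ℕ} → BFormula n → (Fin n → Super X) → Prop
  | _, .mem i j, e => e i ∈ e j
  | _, .eq i j, e => e i = e j
  | _, .not φ, e => ¬ φ.Holds e
  | _, .and φ ψ, e => φ.Holds e ∧ ψ.Holds e
  | _, .or φ ψ, e => φ.Holds e ∨ ψ.Holds e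
  | _, .imp φ ψ, e => φ.Holds e → ψ.Holds e
  | n, .ball i φ, e => ∀ y : Super X, y ∈ e i →
      φ.Holds (Fin.snoc (α := fun _ : Fin (n + 1) => Super X) e y)
  | n, .bex i φ, e => ∃ y : Super X, y ∈ e i ∧
      φ.Holds (Fin.snoc (α := fun _ : Fin (n + 1) => Super X) e y)

/-- A superstructure model of nonstandard methods `⟨V(X), V(Y), ∗⟩`: `X` is an infinite set of
individuals and `∗ : V(X) → V(Y)` satisfies the transfer principle for all bounded formulas with
parameters. The single superstructure models are those with `X = Y`. -/
structure SuperstructureModel (X Y : ZFSet.{u}) where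
  base_left : IsBaseSet X
  base_right : IsBaseSet Y
  infinite : {a | a ∈ X}.Infinite
  star : Super X → Super Y
  transfer : ∀ (n : ℕ) (φ : BFormula n) (a : Fin n → Super X),
    φ.Holds a ↔ φ.Holds (fun i => star (a i))

/-! ### Subsets, ordered tuples and products inside a superstructure -/

theorem level_mono (X : ZFSet.{u}) {m n : ℕ} (h : m ≤ n) : level X m ⊆ level X n := by
  induction h with
  | refl => exact fun _ h => h
  | step _ ih => exact fun z hz => ZFSet.mem_union.2 (Or.inl (ih hz))

theorem mem_level_succ {X A : ZFSet.{u}} {n : ℕ} (h : A ⊆ level X n) : A ∈ level X (n + 1) :=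
  ZFSet.mem_union.2 (Or.inr (ZFSet.mem_powerset.2 h))

/-- The elements of `S ∈ V(X)`. -/
def Elt {X : ZFSet.{u}} (S : Super X) : Type (u + 1) := {a : Super X // a ∈ S}

theorem exists_level {X : ZFSet.{u}} (hX : IsBaseSet X) (S : Super X) :
    ∃ n, ∀ a : Super X, a ∈ S → a.1 ∈ level X n := by
  obtain ⟨S, n, hS⟩ := S
  induction n with
  | zero => exact ⟨0, fun a ha => (hX.2 S hS a.1 ha a.2).elim⟩
  | succ n ih =>
    rcases ZFSet.mem_union.1 hS with h | h
    · exact ih h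
    · exact ⟨n, fun a ha => ZFSet.mem_powerset.1 h ha⟩

/-- A collection of elements of `S ∈ V(X)`, as an element of `V(X)`. -/
noncomputable def subset {X : ZFSet.{u}} (hX : IsBaseSet X) (S : Super X) (A : Set (Elt S)) :
    Super X :=
  ⟨ZFSet.sep (fun z => ∃ a ∈ A, a.1.1 = z) S.1, by
    obtain ⟨n, hn⟩ := exists_level hX S
    refine ⟨n + 1, mem_level_succ fun z hz => ?_⟩
    obtain ⟨-, a, -, rfl⟩ := ZFSet.mem_sep.1 hz
    exact hn a.1 a.2⟩

theorem mem_subset {X : ZFSet.{u}} (hX : IsBaseSet X) (S : Super X) (A : Set (Elt S))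
    (a : Super X) : a ∈ subset hX S A ↔ ∃ h : a ∈ S, (⟨a, h⟩ : Elt S) ∈ A := by
  change a.1 ∈ (subset hX S A).1 ↔ _
  simp only [subset, ZFSet.mem_sep]
  constructor
  · rintro ⟨-, b, hb, e⟩
    have e' : b.1 = a := Subtype.ext e
    subst e'
    exact ⟨b.2, hb⟩
  · rintro ⟨h, hA⟩
    exact ⟨h, _, hA, rfl⟩

theorem pair_mem_level {X a b : ZFSet.{u}} {n : ℕ} (ha : a ∈ level X n) (hb : b ∈ level X n) :
    ZFSet.pair a b ∈ level X (n + 2) := by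
  refine mem_level_succ fun z hz => ?_
  rcases ZFSet.mem_pair.1 hz with rfl | rfl
  · exact mem_level_succ fun w hw => by rwa [ZFSet.mem_singleton.1 hw]
  · refine mem_level_succ fun w hw => ?_
    rcases ZFSet.mem_pair.1 hw with rfl | rfl <;> assumption

/-- The (Kuratowski) ordered pair in `V(X)`. -/
noncomputable def pair {X : ZFSet.{u}} (a b : Super X) : Super X :=
  ⟨ZFSet.pair a.1 b.1, by
    obtain ⟨m, hm⟩ := a.2
    obtain ⟨n, hn⟩ := b.2
    exact ⟨_, pair_mem_level (level_mono X (le_max_left m n) hm)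
      (level_mono X (le_max_right m n) hn)⟩⟩

/-- The Cartesian product in `V(X)`. -/
noncomputable def prod {X : ZFSet.{u}} (hX : IsBaseSet X) (A B : Super X) : Super X :=
  ⟨ZFSet.sep (fun z => ∃ a b : Super X, a ∈ A ∧ b ∈ B ∧ (pair a b).1 = z) (ZFSet.prod A.1 B.1), by
    obtain ⟨m, hm⟩ := exists_level hX A
    obtain ⟨n, hn⟩ := exists_level hX B
    refine ⟨max m n + 2 + 1, mem_level_succ fun z hz => ?_⟩
    obtain ⟨-, a, b, ha, hb, rfl⟩ := ZFSet.mem_sep.1 hz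
    exact pair_mem_level (level_mono X (le_max_left m n) (hm a ha))
      (level_mono X (le_max_right m n) (hn b hb))⟩

theorem mem_prod {X : ZFSet.{u}} (hX : IsBaseSet X) (A B z : Super X) :
    z ∈ prod hX A B ↔ ∃ a b : Super X, a ∈ A ∧ b ∈ B ∧ pair a b = z := by
  change z.1 ∈ (prod hX A B).1 ↔ _
  simp only [prod, ZFSet.mem_sep]
  constructor
  · rintro ⟨-, a, b, ha, hb, e⟩
    exact ⟨a, b, ha, hb, Subtype.ext e⟩
  · rintro ⟨a, b, ha, hb, rfl⟩
    exact ⟨ZFSet.pair_mem_prod.2 ⟨ha, hb⟩, a, b, ha, hb, rfl⟩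

/-- The ordered tuple `(a₀, …, aₙ) = ((a₀, …, aₙ₋₁), aₙ)` in `V(X)`. -/
noncomputable def tuple {X : ZFSet.{u}} : {n : ℕ} → (Fin (n + 1) → Super X) → Super X
  | 0, a => a 0
  | n + 1, a => pair (tuple (n := n) (fun i => a i.castSucc)) (a (Fin.last (n + 1)))

/-- The product `S₀ × ⋯ × Sₙ = (S₀ × ⋯ × Sₙ₋₁) × Sₙ` in `V(X)`. -/
noncomputable def prodTuple {X : ZFSet.{u}} (hX : IsBaseSet X) :
    {n : ℕ} → (Fin (n + 1) → Super X) → Super X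
  | 0, S => S 0
  | n + 1, S => prod hX (prodTuple hX (n := n) (fun i => S i.castSucc)) (S (Fin.last (n + 1)))

theorem mem_prodTuple {X : ZFSet.{u}} (hX : IsBaseSet X) {n : ℕ} (S : Fin (n + 1) → Super X)
    (z : Super X) : z ∈ prodTuple hX S ↔ ∃ s : Fin (n + 1) → Super X, (∀ i, s i ∈ S i) ∧
      tuple s = z := by
  induction n generalizing z with
  | zero =>
    constructor
    · intro h
      exact ⟨fun _ => z, fun i => by rw [Fin.fin_one_eq_zero i]; exact h, rfl⟩
    · rintro ⟨s, hs, rfl⟩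
      exact hs 0
  | succ n ih =>
    refine (mem_prod hX _ _ z).trans ?_
    constructor
    · rintro ⟨a, b, ha, hb, rfl⟩
      obtain ⟨s, hs, rfl⟩ := (ih _ a).1 ha
      refine ⟨Fin.snoc (α := fun _ => Super X) s b, fun i => ?_, by simp [tuple]⟩
      refine Fin.lastCases ?_ (fun j => ?_) i
      · simpa using hb
      · simpa using hs j
    · rintro ⟨s, hs, rfl⟩
      exact ⟨_, _, (ih _ _).2 ⟨_, fun i => hs i.castSucc, rfl⟩, hs _, rfl⟩

/-- The bijection from families `(sᵢ ∈ Sᵢ)ᵢ` to elements `(s₀, …, sₙ)` of `S₀ × ⋯ × Sₙ`. -/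
noncomputable def tupleElt {X : ZFSet.{u}} (hX : IsBaseSet X) {n : ℕ}
    (S : Fin (n + 1) → Super X) (s : ∀ i, Elt (S i)) : Elt (prodTuple hX S) :=
  ⟨tuple fun i => (s i).1, (mem_prodTuple hX S _).2 ⟨_, fun i => (s i).2, rfl⟩⟩

/-! ### The ultrafilter generated by a point of `∗S` -/

namespace SuperstructureModel

variable {X Y : ZFSet.{u}} (M : SuperstructureModel X Y)

theorem star_inter {A B C : Super X} (h : ∀ x : Super X, x ∈ A → x ∈ B → x ∈ C) (x : Super Y)
    (hA : x ∈ M.star A) (hB : x ∈ M.star B) : x ∈ M.star C :=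
  (M.transfer 3 (.ball 0 (.imp (.mem 3 1) (.mem 3 2))) ![A, B, C]).1 h x hA hB

theorem star_compl {S A B : Super X} (h : ∀ x : Super X, x ∈ S → (x ∈ A ↔ x ∉ B)) (x : Super Y)
    (hS : x ∈ M.star S) : x ∈ M.star A ↔ x ∉ M.star B := by
  have := (M.transfer 3 (.ball 0 (.and (.imp (.mem 3 1) (.not (.mem 3 2)))
    (.imp (.not (.mem 3 2)) (.mem 3 1)))) ![S, A, B]).1
    (fun y hy => ⟨(h y hy).1, (h y hy).2⟩) x hS
  exact ⟨this.1, this.2⟩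

/-- For `α ∈ ∗S`, the ultrafilter `𝔘_α = {A ⊆ S | α ∈ ∗A}` on `S`. -/
noncomputable def gen (S : Super X) (α : Super Y) (hα : α ∈ M.star S) : Ultrafilter (Elt S) :=
  Ultrafilter.ofComplNotMemIff
    { sets := {A | α ∈ M.star (subset M.base_left S A)}
      univ_sets := M.star_inter (A := S) (B := S)
        (fun x hx _ => (mem_subset _ _ Set.univ _).2 ⟨hx, Set.mem_univ _⟩) α hα hα
      sets_of_superset := fun {A B} hA hAB => M.star_inter
        (fun x hx _ => by
          obtain ⟨h, hxA⟩ := (mem_subset _ _ _ _).1 hx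
          exact (mem_subset _ _ _ _).2 ⟨h, hAB hxA⟩) α hA hA
      inter_sets := fun {A B} hA hB => M.star_inter
        (fun x hx hx' => by
          obtain ⟨h, hxA⟩ := (mem_subset _ _ _ _).1 hx
          obtain ⟨h', hxB⟩ := (mem_subset _ _ _ _).1 hx'
          exact (mem_subset _ _ (A ∩ B) _).2 ⟨h, hxA, hxB⟩) α hA hB }
    (fun A => (M.star_compl (S := S) (A := subset M.base_left S A)
      (B := subset M.base_left S Aᶜ) (fun x hx => by
        rw [mem_subset, mem_subset]
        constructor
        · rintro ⟨_, h⟩ ⟨_, h'⟩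
          exact h' h
        · intro h
          by_contra h'
          exact h ⟨hx, fun h'' => h' ⟨hx, h''⟩⟩) α hα).symm)

theorem mem_gen (S : Super X) (α : Super Y) (hα : α ∈ M.star S) (A : Set (Elt S)) :
    A ∈ M.gen S α hα ↔ α ∈ M.star (subset M.base_left S A) := Iff.rfl

end SuperstructureModel

/-! ### Tensor products of ultrafilters and tensor tuples -/

/-- The tensor product `U₀ ⊗ ⋯ ⊗ Uₙ₋₁`, an ultrafilter on `T₀ × ⋯ × Tₙ₋₁`: the set `A` belongs to
it if and only if `{s₀ | {s₁ | … {sₙ₋₁ | (s₀, …, sₙ₋₁) ∈ A} ∈ Uₙ₋₁ … } ∈ U₁} ∈ U₀`. -/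
def tensor : {n : ℕ} → {T : Fin n → Type v} → (∀ i, Ultrafilter (T i)) → Ultrafilter (∀ i, T i)
  | 0, _, _ => pure fun i => i.elim0
  | _ + 1, _, U => (U 0).bind fun s => (tensor fun i => U i.succ).map fun t => Fin.cons s t

theorem mem_tensor_zero {T : Fin 0 → Type v} (U : ∀ i, Ultrafilter (T i)) (A : Set (∀ i, T i)) :
    A ∈ tensor U ↔ (fun i => i.elim0) ∈ A := Iff.rfl

theorem mem_tensor_succ {n : ℕ} {T : Fin (n + 1) → Type v} (U : ∀ i, Ultrafilter (T i))
    (A : Set (∀ i, T i)) : A ∈ tensor U ↔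
      {s : T 0 | {t : ∀ i : Fin n, T i.succ | (Fin.cons s t : ∀ i, T i) ∈ A} ∈
        tensor fun i => U i.succ} ∈ U 0 := Iff.rfl

/-- `(α₀, …, αₙ) ∈ ∗(S₀ × ⋯ × Sₙ)` is a tensor `(n+1)`-ple: `𝔘_(α₀,…,αₙ) = 𝔘_α₀ ⊗ ⋯ ⊗ 𝔘_αₙ`.
(By transfer `hα` implies `hi`, which only serves to form the ultrafilters `𝔘_αᵢ` on `Sᵢ`.) -/
def IsTensorTuple {X Y : ZFSet.{u}} (M : SuperstructureModel X Y) {n : ℕ}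
    (S : Fin (n + 1) → Super X) (α : Fin (n + 1) → Super Y) : Prop :=
  ∃ (hα : tuple α ∈ M.star (prodTuple M.base_left S)) (hi : ∀ i, α i ∈ M.star (S i)),
    M.gen (prodTuple M.base_left S) (tuple α) hα =
      (tensor fun i => M.gen (S i) (α i) (hi i)).map (tupleElt M.base_left S)

end NSA

namespace NSA

/-! ### Bounded formulas for ordered pairs -/

/-! The converse is immediate: the full index set is one of the sets `F`. For the forward direction,
let `p` be the projection of the product onto the factors in `F`. Two facts about `p` suffice.
Nonstandard: if `∗f` sends `α` to `β`, then `𝔘_β` is the image of `𝔘_α` under `f`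
(`StarMap.gen_eq_map`), and `∗p` sends the full tuple to its subtuple. Standard: `p` sends the
tensor product of all the ultrafilters to the tensor product of those indexed by `F`
(`tensor_map_strictMono`), since a quantifier over a coordinate that is not mentioned can be
dropped. Most of the work lies in making `∗p` explicit: functions are handled through their graphs,
and transfer is applied to bounded formulas about Kuratowski pairs. -/

/-- Individuals must be excluded because they have no members inside `V(X)`; a genuine set has all
its members there, so extensionality of `ZFSet` applies. -/
theorem super_ext {X : ZFSet.{u}} {a b : Super X} (ha : IsSet a) (hb : IsSet b)
    (h : ∀ x : Super X, x ∈ a ↔ x ∈ b) : a = b := by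
  have key : ∀ c : Super X, IsSet c → ∀ z ∈ c.1, InSuper X z := by
    rintro ⟨c, n, hn⟩ hc z hz
    induction n with
    | zero => exact (hc hn).elim
    | succ n ih =>
      rcases ZFSet.mem_union.1 hn with h | h
      · exact ih h hc hz
      · exact ⟨n, ZFSet.mem_powerset.1 h hz⟩
  refine Subtype.ext (ZFSet.ext fun z => ⟨fun hz => ?_, fun hz => ?_⟩)
  · exact (h ⟨z, key a ha z hz⟩).1 hz
  · exact (h ⟨z, key b hb z hz⟩).2 hz

theorem isSet_of_mem {X : ZFSet.{u}} (hX : IsBaseSet X) {a b : Super X} (h : a ∈ b) : IsSet b :=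
  fun hb => hX.2 b.1 hb a.1 h a.2

theorem pair_inj {X : ZFSet.{u}} {a b c d : Super X} : pair a b = pair c d ↔ a = c ∧ b = d := by
  constructor
  · intro h
    obtain ⟨h₁, h₂⟩ := ZFSet.pair_inj.1 (congrArg Subtype.val h)
    exact ⟨Subtype.ext h₁, Subtype.ext h₂⟩
  · rintro ⟨rfl, rfl⟩
    rfl

/-- The unordered pair in `V(X)`. -/
noncomputable def upair {X : ZFSet.{u}} (a b : Super X) : Super X :=
  ⟨{a.1, b.1}, by
    obtain ⟨m, hm⟩ := a.2
    obtain ⟨n, hn⟩ := b.2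
    refine ⟨max m n + 1, mem_level_succ fun z hz => ?_⟩
    rcases ZFSet.mem_pair.1 hz with rfl | rfl
    · exact level_mono X (le_max_left m n) hm
    · exact level_mono X (le_max_right m n) hn⟩

theorem mem_upair {X : ZFSet.{u}} {a b x : Super X} : x ∈ upair a b ↔ x = a ∨ x = b := by
  change x.1 ∈ ({a.1, b.1} : ZFSet) ↔ _
  rw [ZFSet.mem_pair]
  exact or_congr Subtype.ext_iff.symm Subtype.ext_iff.symm

theorem pair_eq_upair {X : ZFSet.{u}} (a b : Super X) :
    pair a b = upair (upair a a) (upair a b) := by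
  refine Subtype.ext ?_
  change ({{a.1}, {a.1, b.1}} : ZFSet) = {{a.1, a.1}, {a.1, b.1}}
  rw [ZFSet.pair_eq_singleton]

/-- The right side quantifies only over `z`, so it can be written as a bounded formula. Having a
member already forces `z` to be a set. -/
theorem eq_upair_iff {X : ZFSet.{u}} (hX : IsBaseSet X) {z a b : Super X} :
    z = upair a b ↔ a ∈ z ∧ b ∈ z ∧ ∀ t : Super X, t ∈ z → t = a ∨ t = b := by
  constructor
  · rintro rfl
    exact ⟨mem_upair.2 (.inl rfl), mem_upair.2 (.inr rfl), fun t => mem_upair.1⟩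
  · rintro ⟨ha, hb, h⟩
    refine super_ext (isSet_of_mem hX ha)
      (isSet_of_mem hX (mem_upair.2 (Or.inl (rfl : a = a)))) fun x => ?_
    rw [mem_upair]
    refine ⟨h x, ?_⟩
    rintro (rfl | rfl) <;> assumption

namespace BFormula

/-- The formula `x_z = {x_a, x_b}`. -/
def isUpair {n : ℕ} (z a b : Fin n) : BFormula n :=
  .and (.mem a z) (.and (.mem b z)
    (.ball z (.or (.eq (Fin.last n) a.castSucc) (.eq (Fin.last n) b.castSucc))))

/-- The formula `x_z = (x_a, x_b)`. -/
def isPair {n : ℕ} (z a b : Fin n) : BFormula n :=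
  .bex z (.bex z.castSucc (.and (isUpair z.castSucc.castSucc (Fin.last n).castSucc (Fin.last _))
    (.and (isUpair (Fin.last n).castSucc a.castSucc.castSucc a.castSucc.castSucc)
      (isUpair (Fin.last _) a.castSucc.castSucc b.castSucc.castSucc))))

/-- The formula `(x_a, x_b) ∈ x_g`. -/
def pairMem {n : ℕ} (a b g : Fin n) : BFormula n :=
  .bex g (isPair (Fin.last n) a.castSucc b.castSucc)

variable {X : ZFSet.{u}}

theorem holds_isUpair (hX : IsBaseSet X) {n : ℕ} (z a b : Fin n) (e : Fin n → Super X) :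
    (isUpair z a b).Holds e ↔ e z = upair (e a) (e b) := by
  simp [isUpair, Holds, eq_upair_iff hX]

/-- Valid over every base set: the formula therefore defines pairs in both `V(X)` and `V(Y)`, which
is how transfer carries statements about pairs across. -/
theorem holds_isPair (hX : IsBaseSet X) {n : ℕ} (z a b : Fin n) (e : Fin n → Super X) :
    (isPair z a b).Holds e ↔ e z = pair (e a) (e b) := by
  simp only [isPair, Holds, holds_isUpair hX, Fin.snoc_castSucc, Fin.snoc_last, pair_eq_upair]
  constructor
  · rintro ⟨u, -, v, -, h, rfl, rfl⟩
    exact h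
  · intro h
    exact ⟨_, h ▸ mem_upair.2 (.inl rfl), _, h ▸ mem_upair.2 (.inr rfl), h, rfl, rfl⟩

theorem holds_pairMem (hX : IsBaseSet X) {n : ℕ} (a b g : Fin n) (e : Fin n → Super X) :
    (pairMem a b g).Holds e ↔ pair (e a) (e b) ∈ e g := by
  simp only [pairMem, Holds, holds_isPair hX, Fin.snoc_castSucc, Fin.snoc_last]
  exact ⟨fun ⟨_, h, h'⟩ => h' ▸ h, fun h => ⟨_, h, rfl⟩⟩

end BFormula

/-! ### The nonstandard extension of a map -/

theorem mem_prod_pair {X : ZFSet.{u}} (hX : IsBaseSet X) {A B a b : Super X} :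
    pair a b ∈ prod hX A B ↔ a ∈ A ∧ b ∈ B := by
  rw [mem_prod]
  constructor
  · rintro ⟨a', b', ha, hb, h⟩
    obtain ⟨rfl, rfl⟩ := pair_inj.1 h
    exact ⟨ha, hb⟩
  · rintro ⟨ha, hb⟩
    exact ⟨a, b, ha, hb, rfl⟩

theorem exists_pair_of_elt {X : ZFSet.{u}} {hX : IsBaseSet X} {A B : Super X}
    (z : Elt (prod hX A B)) : ∃ p : Elt A × Elt B, pair p.1.1 p.2.1 = z.1 := by
  obtain ⟨a, b, ha, hb, h⟩ := (mem_prod hX A B z.1).1 z.2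
  exact ⟨(⟨a, ha⟩, ⟨b, hb⟩), h⟩

/-- The first projection of a product in `V(X)`. -/
noncomputable def fstElt {X : ZFSet.{u}} {hX : IsBaseSet X} {A B : Super X}
    (z : Elt (prod hX A B)) : Elt A := (exists_pair_of_elt z).choose.1

/-- The second projection of a product in `V(X)`. -/
noncomputable def sndElt {X : ZFSet.{u}} {hX : IsBaseSet X} {A B : Super X}
    (z : Elt (prod hX A B)) : Elt B := (exists_pair_of_elt z).choose.2

theorem pair_fstElt_sndElt {X : ZFSet.{u}} {hX : IsBaseSet X} {A B : Super X}
    (z : Elt (prod hX A B)) : pair (fstElt z).1 (sndElt z).1 = z.1 :=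
  (exists_pair_of_elt z).choose_spec

/-- The pairing `Elt A → Elt B → Elt (A × B)`. -/
noncomputable def pairElt {X : ZFSet.{u}} (hX : IsBaseSet X) {A B : Super X}
    (a : Elt A) (b : Elt B) : Elt (prod hX A B) :=
  ⟨pair a.1 b.1, (mem_prod_pair hX).2 ⟨a.2, b.2⟩⟩

/-- The graph of a map between sets of `V(X)`. -/
noncomputable def graph {X : ZFSet.{u}} (hX : IsBaseSet X) {S T : Super X}
    (f : Elt S → Elt T) : Super X :=
  subset hX (prod hX S T) {p | ∃ a, p.1 = pair a.1 (f a).1}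

theorem pair_mem_graph {X : ZFSet.{u}} (hX : IsBaseSet X) {S T : Super X}
    (f : Elt S → Elt T) (a b : Super X) :
    pair a b ∈ graph hX f ↔ ∃ h : a ∈ S, (f ⟨a, h⟩).1 = b := by
  rw [graph, mem_subset]
  constructor
  · rintro ⟨_, c, h⟩
    obtain ⟨rfl, rfl⟩ := pair_inj.1 (show pair a b = pair c.1 (f c).1 from h)
    exact ⟨c.2, rfl⟩
  · rintro ⟨h, rfl⟩
    exact ⟨(mem_prod_pair hX).2 ⟨h, (f ⟨a, h⟩).2⟩, _, rfl⟩

namespace SuperstructureModel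

variable {X Y : ZFSet.{u}} (M : SuperstructureModel X Y)

/-- The point `β ∈ ∗T` is the value at `α ∈ ∗S` of the nonstandard extension `∗f` of
`f : S → T`. -/
def StarMap {S T : Super X} (f : Elt S → Elt T) (α β : Super Y) : Prop :=
  α ∈ M.star S ∧ β ∈ M.star T ∧ pair α β ∈ M.star (graph M.base_left f)

variable {M}

open BFormula in
theorem StarMap.refl {S : Super X} {α : Super Y} (hα : α ∈ M.star S) :
    M.StarMap (id : Elt S → Elt S) α α := by
  have := (M.transfer 2 (.ball 0 (pairMem 2 2 1)) ![S, graph M.base_left (id : Elt S → Elt S)]).1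
    fun a ha => (holds_pairMem M.base_left _ _ _ _).2 ((pair_mem_graph _ _ _ _).2 ⟨ha, rfl⟩)
  exact ⟨hα, hα, (holds_pairMem M.base_right _ _ _ _).1 (this α hα)⟩

open BFormula in
theorem StarMap.comp {S T U : Super X} {f : Elt S → Elt T} {g : Elt T → Elt U} {α β γ : Super Y}
    (hg : M.StarMap g β γ) (hf : M.StarMap f α β) : M.StarMap (g ∘ f) α γ := by
  -- Variables 0 to 5 are the parameters; 6, 7 and 8 are the bound points of `S`, `T` and `U`. The
  -- formulas below follow the same numbering convention.
  have := (M.transfer 6 (.ball 0 (.ball 1 (.ball 2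
    (.imp (pairMem 6 7 3) (.imp (pairMem 7 8 4) (pairMem 6 8 5))))))
    ![S, T, U, graph M.base_left f, graph M.base_left g, graph M.base_left (g ∘ f)]).1
    fun a ha b hb c hc h₁ h₂ => by
      obtain ⟨h, e⟩ := (pair_mem_graph _ f a b).1 ((holds_pairMem M.base_left _ _ _ _).1 h₁)
      subst e
      obtain ⟨h', e⟩ := (pair_mem_graph _ g (f ⟨a, h⟩).1 c).1
        ((holds_pairMem M.base_left _ _ _ _).1 h₂)
      subst e
      exact (holds_pairMem M.base_left _ _ _ _).2 ((pair_mem_graph _ (g ∘ f) a _).2 ⟨h, rfl⟩)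
  exact ⟨hf.1, hg.2.1, (holds_pairMem M.base_right _ _ _ _).1
    (this α hf.1 β hf.2.1 γ hg.2.1 ((holds_pairMem M.base_right _ _ _ _).2 hf.2.2)
      ((holds_pairMem M.base_right _ _ _ _).2 hg.2.2))⟩

open BFormula in
-- Transfers that each point of `A × B` is the pair of its projections; injectivity of pairing in
-- `V(Y)` then identifies the components obtained with `α` and `β`.
theorem starMap_fst_snd {A B : Super X} {α β : Super Y}
    (h : pair α β ∈ M.star (prod M.base_left A B)) :
    M.StarMap (fstElt : Elt (prod M.base_left A B) → Elt A) (pair α β) α ∧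
      M.StarMap (sndElt : Elt (prod M.base_left A B) → Elt B) (pair α β) β := by
  obtain ⟨a, ha, b, hb, h₁, h₂, h₃⟩ := (M.transfer 5 (.ball 0 (.bex 1 (.bex 2
    (.and (isPair 5 6 7) (.and (pairMem 5 6 3) (pairMem 5 7 4))))))
    ![prod M.base_left A B, A, B,
      graph M.base_left (fstElt : Elt (prod M.base_left A B) → Elt A),
      graph M.base_left (sndElt : Elt (prod M.base_left A B) → Elt B)]).1
    (fun z hz => ⟨(fstElt (⟨z, hz⟩ : Elt (prod M.base_left A B))).1, (fstElt _).2,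
      (sndElt (⟨z, hz⟩ : Elt (prod M.base_left A B))).1, (sndElt _).2,
      (holds_isPair M.base_left _ _ _ _).2 (pair_fstElt_sndElt (⟨z, hz⟩ : Elt _)).symm,
      (holds_pairMem M.base_left _ _ _ _).2 ((pair_mem_graph _ fstElt z _).2 ⟨hz, rfl⟩),
      (holds_pairMem M.base_left _ _ _ _).2 ((pair_mem_graph _ sndElt z _).2 ⟨hz, rfl⟩)⟩)
    (pair α β) h
  obtain ⟨e, e'⟩ := pair_inj.1 ((holds_isPair M.base_right _ _ _ _).1 h₁ : pair α β = pair a b)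
  subst e e'
  exact ⟨⟨h, ha, (holds_pairMem M.base_right _ _ _ _).1 h₂⟩,
    ⟨h, hb, (holds_pairMem M.base_right _ _ _ _).1 h₃⟩⟩

open BFormula in
theorem StarMap.pairing {S A B : Super X} {f : Elt S → Elt A} {g : Elt S → Elt B}
    {σ α β : Super Y} (hf : M.StarMap f σ α) (hg : M.StarMap g σ β) :
    M.StarMap (fun s => pairElt M.base_left (f s) (g s)) σ (pair α β) := by
  obtain ⟨p, hp, h₁, h₂⟩ := (M.transfer 7 (.ball 0 (.ball 1 (.ball 2
    (.imp (pairMem 7 8 4) (.imp (pairMem 7 9 5)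
      (.bex 3 (.and (isPair 10 8 9) (pairMem 7 10 6))))))))
    ![S, A, B, prod M.base_left A B, graph M.base_left f, graph M.base_left g,
      graph M.base_left fun s => pairElt M.base_left (f s) (g s)]).1
    (fun a ha b hb c hc h₁ h₂ => by
      obtain ⟨h, e⟩ := (pair_mem_graph _ f a b).1 ((holds_pairMem M.base_left _ _ _ _).1 h₁)
      obtain ⟨h', e'⟩ := (pair_mem_graph _ g a c).1 ((holds_pairMem M.base_left _ _ _ _).1 h₂)
      subst e e'
      exact ⟨_, (pairElt M.base_left (f ⟨a, h⟩) (g ⟨a, h⟩)).2,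
        (holds_isPair M.base_left _ _ _ _).2 rfl, (holds_pairMem M.base_left _ _ _ _).2
          ((pair_mem_graph _ (fun s => pairElt M.base_left (f s) (g s)) a _).2 ⟨h, rfl⟩)⟩)
    σ hf.1 α hf.2.1 β hg.2.1 ((holds_pairMem M.base_right _ _ _ _).2 hf.2.2)
      ((holds_pairMem M.base_right _ _ _ _).2 hg.2.2)
  have e : p = pair α β := (holds_isPair M.base_right _ _ _ _).1 h₁
  subst e
  exact ⟨hf.1, hp, (holds_pairMem M.base_right _ _ _ _).1 h₂⟩

open BFormula in
-- Transfer of `f a ∈ B ↔ a ∈ f ⁻¹' B`, evaluated at `α` and `β`.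
theorem StarMap.gen_eq_map {S T : Super X} {f : Elt S → Elt T} {α β : Super Y}
    (hf : M.StarMap f α β) : M.gen T β hf.2.1 = (M.gen S α hf.1).map f := by
  ext B
  have h := (M.transfer 5 (.ball 0 (.ball 1 (.imp (pairMem 5 6 2)
    (.and (.imp (.mem 6 4) (.mem 5 3)) (.imp (.mem 5 3) (.mem 6 4))))))
    ![S, T, graph M.base_left f, subset M.base_left S (f ⁻¹' B), subset M.base_left T B]).1
    (fun a ha b hb h₁ => by
      obtain ⟨h, e⟩ := (pair_mem_graph _ f a b).1 ((holds_pairMem M.base_left _ _ _ _).1 h₁)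
      subst e
      exact ⟨fun h' => (mem_subset M.base_left _ _ _).2 ⟨h, ((mem_subset M.base_left _ _ _).1 h').2⟩,
        fun h' => (mem_subset M.base_left _ _ _).2 ⟨(f ⟨a, h⟩).2, ((mem_subset M.base_left _ _ _).1 h').2⟩⟩)
    α hf.1 β hf.2.1 ((holds_pairMem M.base_right _ _ _ _).2 hf.2.2)
  exact ⟨h.1, h.2⟩

theorem StarMap.tuple {S : Super X} {σ : Super Y} {n : ℕ} {T : Fin (n + 1) → Super X}
    {f : ∀ j, Elt S → Elt (T j)} {β : Fin (n + 1) → Super Y} (h : ∀ j, M.StarMap (f j) σ (β j)) :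
    M.StarMap (fun s => tupleElt M.base_left T fun j => f j s) σ (tuple β) := by
  induction n with
  | zero => exact h 0
  | succ n ih => exact (ih fun j => h j.castSucc).pairing (h (Fin.last _))

variable (M)

/-- Tuples are nested to the left, so the last coordinate is a second projection and the others are
reached through the first. -/
theorem exists_starMap_proj {n : ℕ} (S : Fin (n + 1) → Super X) (j : Fin (n + 1)) :
    ∃ π : Elt (prodTuple M.base_left S) → Elt (S j),
      (∀ s, π (tupleElt M.base_left S s) = s j) ∧
      ∀ α : Fin (n + 1) → Super Y, NSA.tuple α ∈ M.star (prodTuple M.base_left S) →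
        M.StarMap π (NSA.tuple α) (α j) := by
  induction n with
  | zero =>
    obtain rfl := Fin.fin_one_eq_zero j
    exact ⟨id, fun s => rfl, fun α hα => StarMap.refl hα⟩
  | succ n ih =>
    have h := fun s => pair_inj.1 (pair_fstElt_sndElt (tupleElt M.base_left S s))
    induction j using Fin.lastCases with
    | last => exact ⟨sndElt, fun s => Subtype.ext (h s).2, fun α hα => (starMap_fst_snd hα).2⟩
    | cast j =>
      obtain ⟨π, h₁, h₂⟩ := ih (fun j => S j.castSucc) j
      refine ⟨π ∘ fstElt, fun s => ?_, fun α hα => ?_⟩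
      · have : fstElt (tupleElt M.base_left S s) = tupleElt M.base_left
            (fun j => S j.castSucc) fun j => s j.castSucc := Subtype.ext (h s).1
        exact (congrArg π this).trans (h₁ _)
      · have := (starMap_fst_snd hα).1
        exact (h₂ _ this.2.1).comp this

end SuperstructureModel

/-! ### Tensor products restricted to a subset of the factors -/

/-- Induction on the number of factors, peeling off the outermost quantifier. Monotonicity matters
because the tensor product depends on the order of its factors. -/
theorem tensor_map_strictMono {m n : ℕ} {T : Fin n → Type v} (U : ∀ i, Ultrafilter (T i))
    (i : Fin m → Fin n) (hi : StrictMono i) :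
    (tensor U).map (fun s j => s (i j)) = tensor fun j => U (i j) := by
  induction n generalizing m with
  | zero =>
    cases m with
    | zero =>
      ext A
      exact iff_of_eq (congrArg (· ∈ A) (funext fun j => j.elim0))
    | succ m => exact (i 0).elim0
  | succ n ih =>
    by_cases h0 : ∀ j, i j ≠ 0
    · obtain ⟨i, rfl⟩ : ∃ i' : Fin m → Fin n, i = fun j => (i' j).succ :=
        ⟨fun j => (i j).pred (h0 j), by simp⟩
      refine Eq.trans ?_ (ih (fun j => U j.succ) i fun a b h => Fin.succ_lt_succ_iff.1 (hi h))
      ext A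
      -- Coordinate 0 is not selected, so the condition is constant in it and the quantifier over `U
      -- 0` is vacuous.
      exact Filter.eventually_const (f := (U 0 : Filter (T 0)))
        (p := {t | (fun j => t (i j)) ∈ A} ∈ tensor fun j => U j.succ)
    · obtain ⟨j, hj⟩ := not_forall_not.1 h0
      cases m with
      | zero => exact j.elim0
      | succ m =>
        -- Coordinate 0 is selected, necessarily first; both sides then begin with the quantifier
        -- over `U 0`, and induction applies to the remaining coordinates.
        have hi0 : i 0 = 0 := le_antisymm (hj ▸ hi.monotone (Fin.zero_le j)) (Fin.zero_le _)
        have hne : ∀ j : Fin m, i j.succ ≠ 0 := fun j h =>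
          (hi (Fin.succ_pos j)).ne (hi0.trans h.symm)
        obtain ⟨i, rfl⟩ : ∃ i' : Fin m → Fin n,
            i = Fin.cons (α := fun _ => Fin (n + 1)) 0 fun j => (i' j).succ :=
          ⟨fun j => (i j.succ).pred (hne j), by
            funext j
            refine Fin.cases ?_ (fun j => ?_) j
            · simpa using hi0
            · simp⟩
        have := ih (fun j => U j.succ) i fun a b h =>
          Fin.succ_lt_succ_iff.1 (hi (Fin.succ_lt_succ_iff.2 h))
        ext A
        rw [mem_tensor_succ]
        change {s : T 0 | _} ∈ U 0 ↔ {s : T 0 | _ ∈ tensor fun j => U (i j).succ} ∈ U 0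
        rw [← this]
        refine iff_of_eq (congrArg (· ∈ U 0) (Set.ext fun s => ?_))
        refine iff_of_eq (congrArg (· ∈ tensor fun j => U j.succ) (Set.ext fun t => ?_))
        refine iff_of_eq (congrArg (· ∈ A) (funext fun j => ?_))
        exact Fin.cases rfl (fun _ => rfl) j

theorem IsTensorTuple.comp_strictMono {X Y : ZFSet.{u}} {M : SuperstructureModel X Y} {n l : ℕ}
    {S : Fin (n + 1) → Super X} {α : Fin (n + 1) → Super Y} (h : IsTensorTuple M S α)
    (i : Fin (l + 1) → Fin (n + 1)) (hi : StrictMono i) :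
    IsTensorTuple M (fun j => S (i j)) (fun j => α (i j)) := by
  obtain ⟨hα, hαi, h⟩ := h
  choose π h₁ h₂ using M.exists_starMap_proj S
  -- The projection `p` onto the selected factors, with `∗p` sending the full tuple to the subtuple.
  have hp := SuperstructureModel.StarMap.tuple fun j => h₂ (i j) α hα
  refine ⟨hp.2.1, fun j => hαi (i j), ?_⟩
  rw [hp.gen_eq_map, h, ← tensor_map_strictMono (fun j => M.gen (S j) (α j) (hαi j)) i hi,
    Ultrafilter.map_map, Ultrafilter.map_map]
  -- Both sides are now images of the full tensor product; the two maps agree because each `π` reads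
  -- off its coordinate.
  congr 1
  funext s
  simp [h₁]

end NSA

theorem mainTheorem5 {X Y : ZFSet.{u}} (M : NSA.SuperstructureModel X Y) (k : ℕ) (hk : 1 ≤ k)
    (S : Fin (k + 1) → NSA.Super X) (hS : ∀ i, NSA.IsSet (S i))
    (α : Fin (k + 1) → NSA.Super Y)
    (hα : NSA.tuple α ∈ M.star (NSA.prodTuple M.base_left S)) :
    NSA.IsTensorTuple M S α ↔
      ∀ (l : ℕ) (i : Fin (l + 1) → Fin (k + 1)), StrictMono i →
        NSA.IsTensorTuple M (fun j => S (i j)) (fun j => α (i j)) :=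
  ⟨fun h _ i hi => h.comp_strictMono i hi, fun h => h k id strictMono_id⟩
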